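/- **Conventions.** All $C^*$-algebras are unital, and representations on Hilbert spaces are unital $*$-homomorphisms. Let $A$ be a unital $C^*$-algebra and $\alpha$ an injective unital $*$-endomorphism of $A$. A covariant representation of $(A,\alpha)$ is a triple $(H,\pi,W)$ with $\pi:A\to\mathcal B(H)$ a representation and $W\in\mathcal B(H)$ an isometry such that $\pi(\alpha(a))W=W\pi(a)$ for all $a\in A$ and $W^kW^{*k}\in\pi(A)'$ for all $k\in\mathbb N$. The crossed product $A\rtimes_\alpha\mathbb N$ is a unital $C^*$-algebra $B$ with an injective unital $*$-homomorphism $\iota:A\to B$ and an isometry $t\in B$ such that: (1) $B$ is generated as a $C^*$-algebra by $\iota(A)$ and $t$; (2) $\iota(\alpha(a))t=t\iota(a)$ for $a\in A$; (3) $t^kt^{*k}$ commutes with $\iota(A)$ for $k\in\mathbb N$; (4) for every covariant representation $(H,\pi,W)$ of $(A,\alpha)$ there is a representation $\widehat\pi$ of $B$ on $H$ with $\widehat\pi\circ\iota=\pi$ and $\widehat\pi(t)=W$. For $\theta\in\mathbb R$, the universal $C^*$-algebra generated by a unitary $U$ and an isometry $V$ with $UV=e^{2\pi i\theta}VU$ is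 a unital $C^*$-algebra generated by a unitary $U$ and an isometry $V$ satisfying this relation, such that for every Hilbert space $H$, unitary $u\in\mathcal B(H)$ and isometry $v\in\mathcal B(H)$ with $uv=e^{2\pi i\theta}vu$ there is a representation of the algebra on $H$ that maps $U$ to $u$ and $V$ to $v$. **Theorem.** Let $\theta$ be irrational and let $\alpha_\theta$ be the rotation $(\alpha_\theta f)(x)=f(x-\theta)$ of $C(\mathbb R/\mathbb Z)$. The crossed product $C(\mathbb R/\mathbb Z)\rtimes_{\alpha_\theta}\mathbb N$ exists, and it coincides with the universal $C^*$-algebra generated by a unitary $U$ and an isometry $V$ satisfying $UV=e^{2\pi i\theta}VU$. Precisely, if $(B,\iota,t)$ is a crossed product of $C(\mathbb R/\mathbb Z)$ with $\mathbb N$ by $\alpha_\theta$ and $z(x)=e^{2\pi ix}$, then $B$ with $U=\iota(z)$ and $V=t$ is such a universal $C^*$-algebra, and for any other such universal $C^*$-algebra $D$ with generators $U',V'$ there is a unique $*$-isomorphism $\Phi:B\to D$ with $\Phi(\iota(z))=U'$ and $\Phi(t)=V'$. -/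

import Mathlib

open Complex

universe u v

/-- `(H, π, W)` is a covariant representation of `(A, α)`: `π` is a (unital) representation of the
unital C⋆-algebra `A` on the Hilbert space `H`, and `W` is an isometry of `H`. -/
structure IsCovariantRep {A : Type v} [CStarAlgebra A] (α : A →⋆ₐ[ℂ] A)
    {H : Type u} [NormedAddCommGroup H] [InnerProductSpace ℂ H] [CompleteSpace H]
    (π : A →⋆ₐ[ℂ] (H →L[ℂ] H)) (W : H →L[ℂ] H) : Prop where
  isometry : Isometry W
  covariant : ∀ a : A, π (α a) * W = W * π a
  commute : ∀ (k : ℕ) (a : A), Commute (W ^ k * star W ^ k) (π a)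

/-- The unital C⋆-algebra `B`, with `ι : A → B` and `t ∈ B`, is the crossed product `A ⋊_α ℕ` of
the unital C⋆-algebra `A` by the (injective, unital) ⋆-endomorphism `α`. -/
structure IsCrossedProduct {A : Type v} [CStarAlgebra A] (α : A →⋆ₐ[ℂ] A)
    {B : Type u} [CStarAlgebra B] (ι : A →⋆ₐ[ℂ] B) (t : B) : Prop where
  injective : Function.Injective ι
  isometry : star t * t = 1
  generates : (StarAlgebra.adjoin ℂ (Set.range ι ∪ {t})).topologicalClosure = ⊤
  covariant : ∀ a : A, ι (α a) * t = t * ι a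
  commute : ∀ (k : ℕ) (a : A), Commute (t ^ k * star t ^ k) (ι a)
  lift : ∀ (H : Type u) [NormedAddCommGroup H] [InnerProductSpace ℂ H] [CompleteSpace H]
    (π : A →⋆ₐ[ℂ] (H →L[ℂ] H)) (W : H →L[ℂ] H), IsCovariantRep α π W →
      ∃ πhat : B →⋆ₐ[ℂ] (H →L[ℂ] H), (∀ a : A, πhat (ι a) = π a) ∧ πhat t = W

/-- The unital C⋆-algebra `B`, with `U, V ∈ B`, is the universal C⋆-algebra generated by a unitary
`U` and an isometry `V` subject to `U V = exp(2πiθ) V U`. -/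
structure IsUniversalUnitaryIsometry (θ : ℝ) {B : Type u} [CStarAlgebra B] (U V : B) : Prop where
  unitary : U ∈ unitary B
  isometry : star V * V = 1
  relation : U * V = exp (2 * Real.pi * I * θ) • (V * U)
  generates : (StarAlgebra.adjoin ℂ {U, V}).topologicalClosure = ⊤
  lift : ∀ (H : Type u) [NormedAddCommGroup H] [InnerProductSpace ℂ H] [CompleteSpace H]
    (u v : H →L[ℂ] H), u ∈ _root_.unitary (H →L[ℂ] H) → Isometry v →
      u * v = exp (2 * Real.pi * I * θ) • (v * u) →
      ∃ π : B →⋆ₐ[ℂ] (H →L[ℂ] H), π U = u ∧ π V = v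

/-- The rotation `(α_θ f)(x) = f (x - θ)` of `C(ℝ/ℤ)`. -/
noncomputable def rotationHom (θ : ℝ) : C(UnitAddCircle, ℂ) →⋆ₐ[ℂ] C(UnitAddCircle, ℂ) :=
  ContinuousMap.compStarAlgHom' ℂ ℂ
    ⟨fun x : UnitAddCircle => x - (θ : UnitAddCircle), continuous_id.sub continuous_const⟩

/-!
A unitary `u` in a C⋆-algebra is the same thing as a homomorphism from `C(ℝ/ℤ)`, by the continuous
functional calculus (`exists_starAlgHom_fourier_one`), because `C(ℝ/ℤ)` is generated by
`z = fourier 1` (`closure_adjoin_fourier_one`). Since `α_θ z = exp(-2πiθ) z`, the covariance relation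
for an isometry `v`, tested on `z`, is `u v = exp(2πiθ) v u`; conversely this relation implies
covariance on all of `C(ℝ/ℤ)` by density, and it also makes `u` commute with the projections
`v ^ k * star v ^ k` (`covariant_of_relation`, `commute_of_relation`). The two universal properties
therefore describe the same object.

Two facts remain. First, the universal algebra exists
(`exists_isUniversalUnitaryIsometry`): it is generated by a pair in a bounded product of operator
algebras that dominates every other pair in norm. The homomorphism from `C(ℝ/ℤ)` into it is injective
because, on `ℓ²(ℕ)`, the unilateral shift and the diagonal unitaries with entries
`μ * exp(2πiθ) ^ n` satisfy the relation for each `μ` in the unit circle, so that every point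
evaluation of `C(ℝ/ℤ)` is seen in some representation
(`IsUniversalUnitaryIsometry.isCrossedProduct`).

Second, two universal algebras are isomorphic even though universality is only tested on
operators on Hilbert spaces. By Hahn–Banach separation and the GNS construction, Hilbert space
representations separate the points of a C⋆-algebra, and so the universal property extends to
homomorphisms into arbitrary C⋆-algebras (`exists_starAlgHom_of_representations`). Homomorphisms in
both directions are then mutually inverse because they are so on generators.
-/

/-! ### Bounded products of C⋆-algebras and extension of homomorphisms from generators -/

section GelfandNaimark

open scoped ENNReal ComplexOrder CStarAlgebra

/-- The bounded product of nontrivial unital C⋆-algebras. Nontriviality makes the norms of the units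
uniformly equal to `1`, which the unital ring structure on `lp A ∞` asks for. -/
noncomputable instance lp.instCStarAlgebra {I : Type*} {A : I → Type*} [∀ i, Nontrivial (A i)]
    [∀ i, CStarAlgebra (A i)] : CStarAlgebra (lp A ∞) where

/-- A family of homomorphisms `D → A i`, assembled into one homomorphism to the bounded product; it
is well defined since ⋆-homomorphisms of C⋆-algebras are contractive. -/
noncomputable def lpInftyHom {I : Type*} {D : Type*} [CStarAlgebra D] {A : I → Type*}
    [∀ i, Nontrivial (A i)] [∀ i, CStarAlgebra (A i)] (φ : ∀ i, D →⋆ₐ[ℂ] A i) :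
    D →⋆ₐ[ℂ] lp A ∞ where
  toFun d := ⟨fun i => φ i d, memℓp_infty ⟨‖d‖, by
    rintro _ ⟨i, rfl⟩
    exact NonUnitalStarAlgHom.norm_apply_le (φ i) d⟩⟩
  map_one' := by ext i; simp
  map_mul' x y := by ext i; simp
  map_zero' := by ext i; simp
  map_add' x y := by ext i; exact map_add (φ i) x y
  commutes' r := by ext i; simp [Algebra.algebraMap_eq_smul_one]
  map_star' x := by ext i; simp [map_star]

@[simp]
theorem lpInftyHom_apply {I : Type*} {D : Type*} [CStarAlgebra D] {A : I → Type*}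
    [∀ i, Nontrivial (A i)] [∀ i, CStarAlgebra (A i)] (φ : ∀ i, D →⋆ₐ[ℂ] A i) (d : D) (i : I) :
    lpInftyHom φ d i = φ i d := rfl

/-- Evaluation of an element of the bounded product at the index `i`. -/
noncomputable def lpInftyEval {I : Type*} (A : I → Type*)
    [∀ i, Nontrivial (A i)] [∀ i, CStarAlgebra (A i)] (i : I) : lp A ∞ →⋆ₐ[ℂ] A i where
  toFun f := f i
  map_one' := by simp
  map_mul' x y := by simp
  map_zero' := by simp
  map_add' x y := by simp
  commutes' r := by simp [Algebra.algebraMap_eq_smul_one]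
  map_star' x := by simp

/-- To prove a closed property for every element of a C⋆-algebra generated by `s`, it suffices to
prove it on `s` and to check that it is stable under the ⋆-algebra operations. -/
theorem closure_adjoin_induction {B : Type*} [CStarAlgebra B] {s : Set B}
    (hs : (StarAlgebra.adjoin ℂ s).topologicalClosure = ⊤) {p : B → Prop}
    (closed : IsClosed {x | p x}) (mem : ∀ x ∈ s, p x)
    (algebraMap : ∀ r : ℂ, p (algebraMap ℂ B r)) (add : ∀ x y, p x → p y → p (x + y))
    (mul : ∀ x y, p x → p y → p (x * y)) (star : ∀ x, p x → p (star x)) (x : B) : p x := by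
  have hx : x ∈ (StarAlgebra.adjoin ℂ s).topologicalClosure := hs ▸ StarSubalgebra.mem_top
  refine closure_minimal (s := (StarAlgebra.adjoin ℂ s : Set B)) (fun y hy => ?_) closed hx
  exact StarAlgebra.adjoin_induction (p := fun y _ => p y) mem algebraMap
    (fun x y _ _ => add x y) (fun x y _ _ => mul x y) (fun x _ => star x) hy

theorem starAlgHom_ext_of_closure_adjoin {B C : Type*} [CStarAlgebra B] [CStarAlgebra C]
    {s : Set B} (hs : (StarAlgebra.adjoin ℂ s).topologicalClosure = ⊤) {φ ψ : B →⋆ₐ[ℂ] C}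
    (h : ∀ x ∈ s, φ x = ψ x) : φ = ψ := by
  ext x
  refine closure_adjoin_induction hs (p := fun x => φ x = ψ x)
    (isClosed_eq (map_continuous φ) (map_continuous ψ)) h ?_ ?_ ?_ ?_ x
  · intro r; simp only [AlgHomClass.commutes]
  · intro x y hx hy; simp only [map_add, hx, hy]
  · intro x y hx hy; simp only [map_mul, hx, hy]
  · intro x hx; simp only [map_star, hx]

/-- A homomorphism `ψ : B → M` factors through an injective `j : D → M` as soon as it maps generators
of `B` into the range of `j`: an injective ⋆-homomorphism is isometric, so that its range is closed. -/
theorem exists_starAlgHom_lift_of_injective {B D M : Type*} [CStarAlgebra B] [CStarAlgebra D]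
    [CStarAlgebra M] {s : Set B} (hs : (StarAlgebra.adjoin ℂ s).topologicalClosure = ⊤)
    (j : D →⋆ₐ[ℂ] M) (hj : Function.Injective j) (ψ : B →⋆ₐ[ℂ] M)
    (h : ∀ b ∈ s, ψ b ∈ Set.range j) : ∃ χ : B →⋆ₐ[ℂ] D, ∀ b, j (χ b) = ψ b := by
  have hclosed : IsClosed (j.range : Set M) :=
    (NonUnitalStarAlgHom.isometry j hj).isClosedEmbedding.isClosed_range
  have hmem : ∀ b, ψ b ∈ j.range := by
    refine closure_adjoin_induction hs (p := fun b => ψ b ∈ j.range)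
      (hclosed.preimage (map_continuous ψ)) h ?_ ?_ ?_ ?_
    · intro r
      rw [AlgHomClass.commutes]
      exact algebraMap_mem _ r
    · intro x y hx hy
      rw [map_add]; exact add_mem hx hy
    · intro x y hx hy
      rw [map_mul]; exact mul_mem hx hy
    · intro x hx
      rw [map_star]; exact star_mem hx
  refine ⟨((StarAlgEquiv.ofInjective j hj).symm : j.range →⋆ₐ[ℂ] D).comp
    (ψ.codRestrict j.range hmem), fun b => ?_⟩
  have := congrArg Subtype.val
    ((StarAlgEquiv.ofInjective j hj).apply_symm_apply (ψ.codRestrict j.range hmem b))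
  exact this

/-! ### Hilbert space representations separate points -/

/-- Positive functionals separate points. The functional comes from the Hahn–Banach separation of
`-(star a * a)` from the closed cone of positive elements. -/
theorem exists_positiveLinearMap_apply_star_mul_self_ne_zero {D : Type*} [CStarAlgebra D]
    [PartialOrder D] [StarOrderedRing D] {a : D} (ha : a ≠ 0) :
    ∃ f : D →ₚ[ℂ] ℂ, f (star a * a) ≠ 0 := by
  let C : ProperCone ℝ D :=
    { carrier := {x | 0 ≤ x}
      add_mem' := fun hx hy => add_nonneg hx hy
      zero_mem' := le_refl (0 : D)
      smul_mem' := fun c x hx => smul_nonneg c.2 hx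
      isClosed' := CStarAlgebra.isClosed_nonneg }
  have hmem : -(star a * a) ∉ C := by
    intro h
    have h' : 0 ≤ -(star a * a) := h
    have h0 : star a * a = 0 := le_antisymm (neg_nonneg.mp h') (star_mul_self_nonneg a)
    exact ha (CStarRing.star_mul_self_eq_zero_iff a |>.mp h0)
  obtain ⟨g, hg, hga⟩ := C.hyperplane_separation_point hmem
  -- Precomposing with the real part makes the complexification of `g` real on self-adjoint
  -- elements.
  let g₀ : Module.Dual ℝ D := g.toLinearMap ∘ₗ (selfAdjoint.submodule ℝ D).subtype ∘ₗ realPart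
  have hg₀ : ∀ x : D, IsSelfAdjoint x → g₀ x = g x := fun x hx => by
    change g (realPart x : D) = g x
    rw [hx.coe_realPart]
  have hg₁ : ∀ x : D, IsSelfAdjoint x → g₀ (I • x) = 0 := fun x hx => by
    change g (realPart (I • x) : D) = 0
    rw [realPart_I_smul, hx.imaginaryPart]
    simp
  have key : ∀ x : D, IsSelfAdjoint x → g₀.extendRCLike x = ((g x : ℝ) : ℂ) := fun x hx => by
    rw [Module.Dual.extendRCLike_apply, hg₀ x hx]
    have := hg₁ x hx
    simp at this ⊢
    exact this
  refine ⟨PositiveLinearMap.mk₀ (g₀.extendRCLike : D →ₗ[ℂ] ℂ) fun x hx => ?_, ?_⟩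
  · rw [key x (.of_nonneg hx)]
    exact_mod_cast hg x hx
  · change g₀.extendRCLike (star a * a) ≠ 0
    rw [key _ (.star_mul_self a)]
    have : g (star a * a) ≠ 0 := by
      intro h
      simp [h] at hga
    exact_mod_cast this

/-- The point-separating half of the Gelfand–Naimark theorem, with the Hilbert space (a GNS space) in
the universe of the algebra. -/
theorem exists_representation_apply_ne_zero {D : Type u} [CStarAlgebra D] {a : D} (ha : a ≠ 0) :
    ∃ (H : Type u) (_ : NormedAddCommGroup H) (_ : InnerProductSpace ℂ H) (_ : CompleteSpace H)
      (π : D →⋆ₐ[ℂ] (H →L[ℂ] H)), π a ≠ 0 := by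
  let _ := CStarAlgebra.spectralOrder D
  have := CStarAlgebra.spectralOrderedRing D
  obtain ⟨f, hf⟩ := exists_positiveLinearMap_apply_star_mul_self_ne_zero ha
  refine ⟨f.GNS, inferInstance, inferInstance, inferInstance, f.gnsStarAlgHom, fun h => hf ?_⟩
  have h1 : f.gnsNonUnitalStarAlgHom a ((f.toPreGNS 1 : f.PreGNS) : f.GNS) = 0 := by
    have : f.gnsNonUnitalStarAlgHom a = 0 := h
    rw [this]; rfl
  rw [PositiveLinearMap.gnsNonUnitalStarAlgHom_apply_coe] at h1
  have h2 := f.preGNS_norm_sq (f.toPreGNS a)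
  rw [PositiveLinearMap.ofPreGNS_toPreGNS] at h2
  rw [← h2]
  have h3 : ‖((f.toPreGNS a : f.PreGNS) : f.GNS)‖ = 0 := by
    simpa using congrArg norm h1
  rw [UniformSpace.Completion.norm_coe] at h3
  simp [h3]

/-- A universal property that is stated only for algebras of operators on Hilbert spaces holds for
all C⋆-algebras `D`: the Gelfand–Naimark embedding of `D` into a bounded product of operator algebras
reduces the general case to the stated one. -/
theorem exists_starAlgHom_of_representations {ι : Type*} {B D : Type u} [CStarAlgebra B]
    [CStarAlgebra D] {x : ι → B}
    (hx : (StarAlgebra.adjoin ℂ (Set.range x)).topologicalClosure = ⊤) (y : ι → D)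
    (h : ∀ (H : Type u) [NormedAddCommGroup H] [InnerProductSpace ℂ H] [CompleteSpace H]
      (π : D →⋆ₐ[ℂ] (H →L[ℂ] H)), ∃ ρ : B →⋆ₐ[ℂ] (H →L[ℂ] H), ∀ i, ρ (x i) = π (y i)) :
    ∃ χ : B →⋆ₐ[ℂ] D, ∀ i, χ (x i) = y i := by
  choose H i₁ i₂ i₃ π hπ using
    fun a : {a : D // a ≠ 0} => exists_representation_apply_ne_zero a.2
  have : ∀ a, Nontrivial (H a →L[ℂ] H a) := fun a => ⟨⟨_, _, hπ a⟩⟩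
  choose ρ hρ using fun a => h (H a) (π a)
  have hinj : Function.Injective (lpInftyHom π) := by
    refine (injective_iff_map_eq_zero _).mpr fun a ha => ?_
    by_contra hne
    refine hπ ⟨a, hne⟩ ?_
    have := congrArg (fun F : lp (fun a => H a →L[ℂ] H a) ∞ => F ⟨a, hne⟩) ha
    simpa using this
  obtain ⟨χ, hχ⟩ := exists_starAlgHom_lift_of_injective hx (lpInftyHom π) hinj (lpInftyHom ρ) (by
    rintro _ ⟨i, rfl⟩
    exact ⟨y i, by ext1; funext a; exact (hρ a i).symm⟩)
  refine ⟨χ, fun i => hinj ?_⟩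
  rw [hχ]
  ext1; funext a; exact hρ a i

end GelfandNaimark

/-! ### Unitaries, functions on the circle and rotation -/

section Circle

open scoped CStarAlgebra

/-- The continuous functional calculus of a unitary, as a homomorphism from `C(ℝ/ℤ)`. -/
theorem exists_starAlgHom_fourier_one {A : Type*} [CStarAlgebra A] {u : A} (hu : u ∈ unitary A) :
    ∃ ι : C(UnitAddCircle, ℂ) →⋆ₐ[ℂ] A, ι (fourier 1) = u := by
  have hn : IsStarNormal u := ⟨by
    rw [commute_iff_eq, Unitary.star_mul_self_of_mem hu, Unitary.mul_star_self_of_mem hu]⟩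
  let e := AddCircle.homeomorphCircle (T := (1 : ℝ)) one_ne_zero
  let c : C(spectrum ℂ u, Circle) :=
    ⟨fun x => ⟨x, by simpa [Submonoid.unitSphere] using spectrum.subset_circle_of_unitary hu x.2⟩,
      by fun_prop⟩
  let r : C(spectrum ℂ u, UnitAddCircle) := ⟨fun x => e.symm (c x), by fun_prop⟩
  refine ⟨(cfcHom (R := ℂ) (a := u) hn).comp (ContinuousMap.compStarAlgHom' ℂ ℂ r), ?_⟩
  have : ContinuousMap.compStarAlgHom' ℂ ℂ r (fourier 1) =
      (ContinuousMap.id ℂ).restrict (spectrum ℂ u) := by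
    ext x
    change fourier 1 (e.symm (c x)) = (x : ℂ)
    rw [fourier_one, ← AddCircle.homeomorphCircle_apply one_ne_zero]
    change ((e (e.symm (c x)) : Circle) : ℂ) = x
    rw [e.apply_symm_apply]
    rfl
  rw [StarAlgHom.comp_apply, this, cfcHom_id]

/-- `C(ℝ/ℤ)` is generated by `fourier 1`, by the Stone–Weierstrass theorem. -/
theorem closure_adjoin_fourier_one :
    (StarAlgebra.adjoin ℂ {(fourier 1 : C(UnitAddCircle, ℂ))}).topologicalClosure = ⊤ := by
  rw [eq_top_iff, ← fourierSubalgebra_closure_eq_top]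
  refine StarSubalgebra.topologicalClosure_mono ?_
  set S := StarAlgebra.adjoin ℂ {(fourier 1 : C(UnitAddCircle, ℂ))}
  have h1 : (fourier 1 : C(UnitAddCircle, ℂ)) ∈ S := StarAlgebra.self_mem_adjoin_singleton ℂ _
  have hnat : ∀ n : ℕ, (fourier n : C(UnitAddCircle, ℂ)) ∈ S := by
    intro n
    induction n with
    | zero =>
      have : (fourier (0 : ℕ) : C(UnitAddCircle, ℂ)) = 1 := by ext x; simp
      rw [this]; exact one_mem S
    | succ n ih =>
      have : (fourier (n + 1 : ℕ) : C(UnitAddCircle, ℂ)) = fourier n * fourier 1 := by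
        ext x; push_cast; exact fourier_add
      rw [this]; exact mul_mem ih h1
  have hint : ∀ n : ℤ, (fourier n : C(UnitAddCircle, ℂ)) ∈ S := by
    intro n
    obtain ⟨m, rfl | rfl⟩ := n.eq_nat_or_neg
    · exact hnat m
    · have : (fourier (-m : ℤ) : C(UnitAddCircle, ℂ)) = star (fourier m) := by
        ext x; exact fourier_neg
      rw [this]; exact star_mem (hnat m)
  intro f hf
  have hle : (fourierSubalgebra : StarSubalgebra ℂ C(UnitAddCircle, ℂ)).toSubalgebra
      ≤ S.toSubalgebra := by
    refine Algebra.adjoin_le ?_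
    rintro _ ⟨n, rfl⟩
    exact hint n
  exact hle hf

theorem fourier_one_mem_unitary :
    (fourier 1 : C(UnitAddCircle, ℂ)) ∈ unitary C(UnitAddCircle, ℂ) := by
  have : star (fourier 1 : C(UnitAddCircle, ℂ)) * fourier 1 = 1 := by
    ext x
    change starRingEnd ℂ (fourier 1 x) * fourier 1 x = 1
    rw [← fourier_neg, ← fourier_add]; simp
  exact ⟨this, by rw [mul_comm]; exact this⟩

theorem rotationHom_fourier_one (θ : ℝ) :
    exp (2 * Real.pi * I * θ) • rotationHom θ (fourier 1) = fourier 1 := by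
  ext x
  change exp (2 * Real.pi * I * θ) * fourier 1 (x - (θ : UnitAddCircle)) = fourier 1 x
  have h : (fourier 1 (θ : UnitAddCircle) : ℂ) = exp (2 * Real.pi * I * θ) := by
    rw [fourier_coe_apply]; simp
  rw [← h]
  simp only [fourier_apply, one_zsmul]
  rw [← Circle.coe_mul, ← AddCircle.toCircle_add, add_sub_cancel]

theorem norm_exp_two_pi_I_mul (θ : ℝ) : ‖exp (2 * Real.pi * I * θ)‖ = 1 := by
  rw [show (2 * Real.pi * I * θ : ℂ) = ((2 * Real.pi * θ : ℝ) : ℂ) * I by push_cast; ring]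
  exact norm_exp_ofReal_mul_I _

theorem star_exp_mul_exp (θ : ℝ) :
    star (exp (2 * Real.pi * I * θ)) * exp (2 * Real.pi * I * θ) = 1 := by
  rw [Complex.star_def, ← normSq_eq_conj_mul_self, normSq_eq_norm_sq, norm_exp_two_pi_I_mul]
  simp

theorem mul_star_eq_of_mul_eq_smul {A : Type*} [CStarAlgebra A] {u w : A} {c : ℂ}
    (hu : u ∈ unitary A) (h : u * w = c • (w * u)) :
    u * star w = star c • (star w * u) := by
  -- The adjoint relation, multiplied by `u` on both sides to replace `star u` by `u`.
  have h1 := congrArg (fun x => u * star x * u) h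
  simp only [star_mul, star_smul] at h1
  have h2 : u * (star w * star u) * u = u * star w := by
    rw [mul_assoc, mul_assoc, Unitary.star_mul_self_of_mem hu, mul_one]
  have h3 : u * (star c • (star u * star w)) * u = star c • (star w * u) := by
    rw [mul_smul_comm, ← mul_assoc, Unitary.mul_star_self_of_mem hu, one_mul, smul_mul_assoc]
  rw [h2, h3] at h1
  exact h1

theorem mul_pow_eq_smul {A : Type*} [CStarAlgebra A] {u w : A} {c : ℂ}
    (h : u * w = c • (w * u)) (k : ℕ) : u * w ^ k = c ^ k • (w ^ k * u) := by
  induction k with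
  | zero => simp
  | succ k ih =>
    rw [pow_succ, ← mul_assoc, ih, smul_mul_assoc, mul_assoc, h, mul_smul_comm, smul_smul,
      ← pow_succ, mul_assoc]

/-- The range projections of the powers of `w` commute with `u`: moving `u` past `w ^ k` produces the
scalar `c ^ k`, moving it past `star w ^ k` produces its conjugate. -/
theorem commute_pow_mul_star_pow {A : Type*} [CStarAlgebra A] {u w : A} {c : ℂ}
    (hu : u ∈ unitary A) (hc : star c * c = 1) (h : u * w = c • (w * u)) (k : ℕ) :
    Commute (w ^ k * star w ^ k) u := by
  have h1 := mul_pow_eq_smul h k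
  have h2 := mul_star_eq_of_mul_eq_smul hu h1
  rw [star_pow] at h2
  rw [commute_iff_eq, ← mul_assoc u, h1, smul_mul_assoc, mul_assoc (w ^ k) u, h2, mul_smul_comm,
    smul_smul, star_pow, ← mul_pow, mul_comm c, hc, one_pow, one_smul, mul_assoc]

theorem commute_of_relation {A : Type*} [CStarAlgebra A] (θ : ℝ)
    (ι : C(UnitAddCircle, ℂ) →⋆ₐ[ℂ] A) {w : A}
    (h : ι (fourier 1) * w = exp (2 * Real.pi * I * θ) • (w * ι (fourier 1))) (k : ℕ)
    (f : C(UnitAddCircle, ℂ)) : Commute (w ^ k * star w ^ k) (ι f) := by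
  have hι : Continuous ι := map_continuous ι
  have hP : star (w ^ k * star w ^ k) = w ^ k * star w ^ k := by simp
  refine closure_adjoin_induction closure_adjoin_fourier_one
    (p := fun f => Commute (w ^ k * star w ^ k) (ι f)) ?_ ?_ ?_ ?_ ?_ ?_ f
  · simp only [commute_iff_eq]
    exact isClosed_eq (by fun_prop) (by fun_prop)
  · rintro _ rfl
    exact commute_pow_mul_star_pow (Unitary.map_mem ι fourier_one_mem_unitary)
      (star_exp_mul_exp θ) h k
  · intro r
    rw [AlgHomClass.commutes]
    exact Algebra.commute_algebraMap_right r _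
  · intro x y hx hy
    rw [map_add]; exact hx.add_right hy
  · intro x y hx hy
    rw [map_mul]; exact hx.mul_right hy
  · intro x hx
    rw [map_star]
    have := hx.star_star
    rwa [hP] at this

theorem covariant_of_relation {A : Type*} [CStarAlgebra A] (θ : ℝ)
    (ι : C(UnitAddCircle, ℂ) →⋆ₐ[ℂ] A) {w : A}
    (h : ι (fourier 1) * w = exp (2 * Real.pi * I * θ) • (w * ι (fourier 1)))
    (f : C(UnitAddCircle, ℂ)) : ι (rotationHom θ f) * w = w * ι f := by
  have hι : Continuous ι := map_continuous ι
  have hα : Continuous (rotationHom θ) := map_continuous _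
  have hu : ι (fourier 1) ∈ unitary A := Unitary.map_mem ι fourier_one_mem_unitary
  have hz := congrArg ι (rotationHom_fourier_one θ)
  rw [map_smul] at hz
  set c := exp (2 * Real.pi * I * θ)
  have hc : star c * c = 1 := star_exp_mul_exp θ
  have hz' : ι (rotationHom θ (fourier 1)) = star c • ι (fourier 1) := by
    rw [← hz, smul_smul, hc, one_smul]
  -- The claim for `star f` is carried along to make the property stable under `star`.
  refine (closure_adjoin_induction closure_adjoin_fourier_one
    (p := fun f => ι (rotationHom θ f) * w = w * ι f ∧
      ι (rotationHom θ (star f)) * w = w * ι (star f)) ?_ ?_ ?_ ?_ ?_ ?_ f).1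
  · exact (isClosed_eq (by fun_prop) (by fun_prop)).inter
      (isClosed_eq (by fun_prop) (by fun_prop))
  · rintro _ rfl
    refine ⟨by rw [hz', smul_mul_assoc, h, smul_smul, hc, one_smul], ?_⟩
    rw [map_star, map_star, map_star, hz', star_smul, star_star, smul_mul_assoc]
    -- The relation for `star u` results from that for `u` by multiplying with `star u` on both sides.
    have h1 := congrArg (fun x => star (ι (fourier 1)) * x * star (ι (fourier 1))) h
    simp only [mul_smul_comm, smul_mul_assoc] at h1
    rw [← mul_assoc, Unitary.star_mul_self_of_mem hu, one_mul, ← mul_assoc, mul_assoc,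
      Unitary.mul_star_self_of_mem hu, mul_one] at h1
    exact h1.symm
  · intro r
    simp only [← algebraMap_star_comm, AlgHomClass.commutes]
    exact ⟨Algebra.commutes r w, Algebra.commutes _ w⟩
  · rintro x y ⟨hx, hx'⟩ ⟨hy, hy'⟩
    simp only [map_add, star_add, add_mul, mul_add, hx, hy, hx', hy', and_self]
  · rintro x y ⟨hx, hx'⟩ ⟨hy, hy'⟩
    constructor
    · rw [map_mul, map_mul, map_mul, mul_assoc, hy, ← mul_assoc, hx, mul_assoc]
    · rw [star_mul, map_mul, map_mul, map_mul, mul_assoc, hx', ← mul_assoc, hy', mul_assoc]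
  · rintro x ⟨hx, hx'⟩
    exact ⟨hx', by rwa [star_star]⟩

theorem relation_of_covariant {A : Type*} [CStarAlgebra A] (θ : ℝ)
    (ι : C(UnitAddCircle, ℂ) →⋆ₐ[ℂ] A) {w : A}
    (h : ι (rotationHom θ (fourier 1)) * w = w * ι (fourier 1)) :
    ι (fourier 1) * w = exp (2 * Real.pi * I * θ) • (w * ι (fourier 1)) := by
  rw [← h, ← smul_mul_assoc, ← map_smul, rotationHom_fourier_one]

end Circle

/-! ### Existence of the universal C⋆-algebra of a unitary and an isometry -/

section UniversalAlgebra

open scoped ENNReal CStarAlgebra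

theorem closure_adjoin_subtype_eq_top {M : Type*} [CStarAlgebra M] {S : StarSubalgebra ℂ M}
    {s : Set S} (hS : S ≤ (StarAlgebra.adjoin ℂ ((↑) '' s : Set M)).topologicalClosure) :
    (StarAlgebra.adjoin ℂ s).topologicalClosure = ⊤ := by
  refine StarSubalgebra.eq_top_iff.mpr fun x => ?_
  change x ∈ closure ((StarAlgebra.adjoin ℂ s : StarSubalgebra ℂ S) : Set S)
  rw [closure_subtype]
  have h := StarAlgHom.map_adjoin S.subtype s
  have h' : ((↑) '' ((StarAlgebra.adjoin ℂ s : StarSubalgebra ℂ S) : Set S) : Set M) =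
      (StarAlgebra.adjoin ℂ ((↑) '' s : Set M) : Set M) := by
    rw [← StarSubalgebra.coe_subtype, ← h]; rfl
  rw [h']
  exact hS x.2

/-- The value at `(a, b)` of a noncommutative ⋆-polynomial in two variables. Such a polynomial is
encoded as an element of the free algebra on four letters, which stand for `a`, `b`, `star a` and
`star b` in this order. -/
noncomputable def freeStarEval {A : Type*} [CStarAlgebra A] (a b : A) :
    FreeAlgebra ℂ (Fin 4) →ₐ[ℂ] A :=
  FreeAlgebra.lift ℂ ![a, b, star a, star b]

theorem map_freeStarEval {A C : Type*} [CStarAlgebra A] [CStarAlgebra C] (φ : A →⋆ₐ[ℂ] C)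
    (a b : A) (p : FreeAlgebra ℂ (Fin 4)) :
    φ (freeStarEval a b p) = freeStarEval (φ a) (φ b) p := by
  have : φ.toAlgHom.comp (freeStarEval a b) = freeStarEval (φ a) (φ b) := by
    refine FreeAlgebra.hom_ext (funext fun i => ?_)
    fin_cases i <;> simp [freeStarEval, map_star]
  exact DFunLike.congr_fun this p

theorem exists_freeStarEval_eq {A : Type*} [CStarAlgebra A] {a b x : A}
    (hx : x ∈ StarAlgebra.adjoin ℂ {a, b}) : ∃ p, freeStarEval a b p = x := by
  have h : (StarAlgebra.adjoin ℂ {a, b}).toSubalgebra ≤ (freeStarEval a b).range := by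
    rw [StarAlgebra.adjoin_toSubalgebra, freeStarEval,
      ← Algebra.adjoin_range_eq_range_freeAlgebra_lift]
    refine Algebra.adjoin_mono ?_
    rintro y ((rfl | rfl) | h)
    · exact ⟨0, rfl⟩
    · exact ⟨1, rfl⟩
    · rcases h with h | h
      · exact ⟨2, by simp [← h]⟩
      · exact ⟨3, by simp [← Set.mem_singleton_iff.mp h]⟩
  exact h hx

theorem isometry_iff_star_mul_self {H : Type*} [NormedAddCommGroup H] [InnerProductSpace ℂ H]
    [CompleteSpace H] {w : H →L[ℂ] H} : Isometry w ↔ star w * w = 1 :=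
  ContinuousLinearMap.isometry_iff_adjoint_comp_self w

/-- A unitary `u` and an isometry `v` with `u v = exp(2πiθ) v u` on a nonzero Hilbert space in the
universe `u`. -/
structure UnitaryIsometryRep (θ : ℝ) : Type (u + 1) where
  H : Type u
  [normed : NormedAddCommGroup H]
  [inner : InnerProductSpace ℂ H]
  [complete : CompleteSpace H]
  [nontrivial : Nontrivial H]
  u : H →L[ℂ] H
  v : H →L[ℂ] H
  unitary : u ∈ _root_.unitary (H →L[ℂ] H)
  isometry : star v * v = 1
  relation : u * v = exp (2 * Real.pi * I * θ) • (v * u)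

attribute [instance] UnitaryIsometryRep.normed UnitaryIsometryRep.inner
  UnitaryIsometryRep.complete UnitaryIsometryRep.nontrivial

namespace UnitaryIsometryRep

/-- The C⋆-seminorm that a pair of operators induces on the noncommutative ⋆-polynomials. -/
noncomputable def freeSeminorm {θ : ℝ} (R : UnitaryIsometryRep.{u} θ) :
    FreeAlgebra ℂ (Fin 4) → ℝ := fun p => ‖freeStarEval R.u R.v p‖

end UnitaryIsometryRep

theorem norm_eq_one_of_star_mul_self_eq_one {A : Type*} [CStarAlgebra A] [Nontrivial A] {v : A}
    (h : star v * v = 1) : ‖v‖ = 1 := by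
  have := CStarRing.norm_star_mul_self (x := v)
  rw [h, norm_one] at this
  nlinarith [norm_nonneg v]

/-- A comparison of the norms of ⋆-polynomials yields a homomorphism. It is read off from its graph,
the C⋆-subalgebra of `B × C` generated by `(U, u)` and `(V, v)`: the norm inequality says that the
projection of the graph to `B` is injective. -/
theorem exists_starAlgHom_of_norm_freeStarEval_le {B C : Type*} [CStarAlgebra B] [CStarAlgebra C]
    {U V : B} (hgen : (StarAlgebra.adjoin ℂ {U, V}).topologicalClosure = ⊤) {u v : C}
    (h : ∀ p, ‖freeStarEval u v p‖ ≤ ‖freeStarEval U V p‖) :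
    ∃ π : B →⋆ₐ[ℂ] C, π U = u ∧ π V = v := by
  let E := (StarAlgebra.adjoin ℂ {((U, u) : B × C), (V, v)}).topologicalClosure
  have hEc : IsClosed (E : Set (B × C)) := StarSubalgebra.isClosed_topologicalClosure _
  have hUE : (U, u) ∈ E :=
    StarSubalgebra.le_topologicalClosure _ (StarAlgebra.subset_adjoin ℂ _ (by simp))
  have hVE : (V, v) ∈ E :=
    StarSubalgebra.le_topologicalClosure _ (StarAlgebra.subset_adjoin ℂ _ (by simp))
  have hnorm : ∀ x ∈ E, ‖x.2‖ ≤ ‖x.1‖ := by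
    intro x hx
    refine closure_minimal (t := {x : B × C | ‖x.2‖ ≤ ‖x.1‖}) ?_
      (isClosed_le (by fun_prop) (by fun_prop)) hx
    intro y hy
    obtain ⟨p, rfl⟩ := exists_freeStarEval_eq hy
    have h1 : (freeStarEval ((U, u) : B × C) (V, v) p).1 = freeStarEval U V p :=
      map_freeStarEval (StarAlgHom.fst ℂ B C) _ _ p
    have h2 : (freeStarEval ((U, u) : B × C) (V, v) p).2 = freeStarEval u v p :=
      map_freeStarEval (StarAlgHom.snd ℂ B C) _ _ p
    rw [Set.mem_ofPred_eq, h1, h2]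
    exact h p
  let j : E →⋆ₐ[ℂ] B := (StarAlgHom.fst ℂ B C).comp E.subtype
  have hj : Function.Injective j := by
    refine (injective_iff_map_eq_zero _).mpr fun x hx => ?_
    have hx1 : x.1.1 = 0 := hx
    have hx2 : x.1.2 = 0 := by
      have := hnorm x.1 x.2
      rw [hx1, norm_zero] at this
      exact norm_le_zero_iff.mp this
    exact Subtype.ext (Prod.ext hx1 hx2)
  obtain ⟨χ, hχ⟩ := exists_starAlgHom_lift_of_injective hgen j hj (StarAlgHom.id ℂ B) (by
    rintro _ (rfl | rfl)
    · exact ⟨⟨_, hUE⟩, rfl⟩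
    · exact ⟨⟨_, hVE⟩, rfl⟩)
  have hχU : χ U = ⟨_, hUE⟩ := hj (hχ _)
  have hχV : χ V = ⟨_, hVE⟩ := hj (hχ _)
  refine ⟨((StarAlgHom.snd ℂ B C).comp E.subtype).comp χ, ?_, ?_⟩
  · rw [StarAlgHom.comp_apply, hχU]; rfl
  · rw [StarAlgHom.comp_apply, hχV]; rfl

/-- There is a pair that dominates all pairs on Hilbert spaces in the universe `u`. These pairs do not
form a type in that universe, but the seminorms that they induce on ⋆-polynomials do; the dominating
pair lives in the bounded product over one representative for each seminorm. -/
theorem exists_pair_norm_freeStarEval_le (θ : ℝ) :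
    ∃ (M : Type u) (_ : CStarAlgebra M) (U V : M), U ∈ unitary M ∧ star V * V = 1 ∧
      U * V = exp (2 * Real.pi * I * θ) • (V * U) ∧
      ∀ (R : UnitaryIsometryRep.{u} θ) (p : FreeAlgebra ℂ (Fin 4)),
        ‖freeStarEval R.u R.v p‖ ≤ ‖freeStarEval U V p‖ := by
  let J := Set.range (UnitaryIsometryRep.freeSeminorm (θ := θ) :
    UnitaryIsometryRep.{u} θ → FreeAlgebra ℂ (Fin 4) → ℝ)
  let R : J → UnitaryIsometryRep.{u} θ := fun i => i.2.choose
  have hR : ∀ i : J, (R i).freeSeminorm = i.1 := fun i => i.2.choose_spec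
  let M := lp (fun i : J => (R i).H →L[ℂ] (R i).H) ∞
  let U : M := ⟨fun i => (R i).u, memℓp_infty ⟨1, by
    rintro _ ⟨i, rfl⟩
    exact (CStarRing.norm_of_mem_unitary (R i).unitary).le⟩⟩
  let V : M := ⟨fun i => (R i).v, memℓp_infty ⟨1, by
    rintro _ ⟨i, rfl⟩
    exact (norm_eq_one_of_star_mul_self_eq_one (R i).isometry).le⟩⟩
  refine ⟨M, inferInstance, U, V, ⟨?_, ?_⟩, ?_, ?_, fun R₀ p => ?_⟩
  · ext1; funext i; exact Unitary.star_mul_self_of_mem (R i).unitary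
  · ext1; funext i; exact Unitary.mul_star_self_of_mem (R i).unitary
  · ext1; funext i; exact (R i).isometry
  · ext1; funext i; exact (R i).relation
  · let i : J := ⟨R₀.freeSeminorm, R₀, rfl⟩
    have h3 : ‖freeStarEval R₀.u R₀.v p‖ = ‖freeStarEval (R i).u (R i).v p‖ :=
      (congrFun (hR i) p).symm
    have h4 : freeStarEval U V p i = freeStarEval (R i).u (R i).v p :=
      map_freeStarEval (lpInftyEval (fun i : J => (R i).H →L[ℂ] (R i).H) i) U V p
    rw [h3, ← h4]
    exact lp.norm_apply_le_norm ENNReal.top_ne_zero _ i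

theorem exists_isUniversalUnitaryIsometry (θ : ℝ) :
    ∃ (B : Type u) (_ : CStarAlgebra B) (U V : B), IsUniversalUnitaryIsometry θ U V := by
  obtain ⟨M, _, U, V, hU, hV, hUV, hle⟩ := exists_pair_norm_freeStarEval_le.{u} θ
  let S := (StarAlgebra.adjoin ℂ {U, V}).topologicalClosure
  have hSc : IsClosed (S : Set M) := StarSubalgebra.isClosed_topologicalClosure _
  have hUS : U ∈ S :=
    StarSubalgebra.le_topologicalClosure _ (StarAlgebra.subset_adjoin ℂ _ (by simp))
  have hVS : V ∈ S :=
    StarSubalgebra.le_topologicalClosure _ (StarAlgebra.subset_adjoin ℂ _ (by simp))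
  have hgen : (StarAlgebra.adjoin ℂ {(⟨U, hUS⟩ : S), ⟨V, hVS⟩}).topologicalClosure = ⊤ := by
    refine closure_adjoin_subtype_eq_top ?_
    rw [Set.image_pair]
  refine ⟨S, inferInstance, ⟨U, hUS⟩, ⟨V, hVS⟩,
    { unitary := ⟨Subtype.ext hU.1, Subtype.ext hU.2⟩
      isometry := Subtype.ext hV
      relation := Subtype.ext hUV
      generates := hgen
      lift := fun H _ _ _ u v hu hv huv =>
        exists_starAlgHom_of_norm_freeStarEval_le hgen fun p => ?_ }⟩
  -- On the zero space all operators vanish, so the norm inequality is trivial there.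
  rcases subsingleton_or_nontrivial H with hH | hH
  · have : freeStarEval u v p = 0 := Subsingleton.elim _ _
    rw [this, norm_zero]
    exact norm_nonneg _
  · have h := hle { H := H, u := u, v := v, unitary := hu
                    isometry := isometry_iff_star_mul_self.mp hv, relation := huv } p
    have h' : S.subtype (freeStarEval ⟨U, hUS⟩ ⟨V, hVS⟩ p) = freeStarEval U V p :=
      map_freeStarEval S.subtype _ _ p
    rw [← h'] at h
    exact h

/-! ### A weighted diagonal unitary and the unilateral shift -/

/-- An orthonormal family extends to an isometry defined on `ℓ²`. -/
theorem exists_isometry_lp_single {ι E : Type*} [DecidableEq ι] [NormedAddCommGroup E]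
    [InnerProductSpace ℂ E] [CompleteSpace E] {b : ι → E} (hb : Orthonormal ℂ b) :
    ∃ T : lp (fun _ : ι => ℂ) 2 →L[ℂ] E, Isometry T ∧ ∀ i, T (lp.single 2 i 1) = b i := by
  refine ⟨hb.orthogonalFamily.linearIsometry.toContinuousLinearMap,
    hb.orthogonalFamily.linearIsometry.isometry, fun i => ?_⟩
  simp

theorem orthonormal_lp_single {ι : Type*} [DecidableEq ι] {σ : ι → ι}
    (hσ : Function.Injective σ) {w : ι → ℂ} (hw : ∀ i, ‖w i‖ = 1) :
    Orthonormal ℂ fun i => (lp.single 2 (σ i) (w i) : lp (fun _ : ι => ℂ) 2) := by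
  refine ⟨fun i => ?_, fun i j hij => ?_⟩
  · rw [lp.norm_single (by norm_num), hw]
  · change inner ℂ (lp.single 2 (σ i) (w i) : lp (fun _ : ι => ℂ) 2) (lp.single 2 (σ j) (w j)) = 0
    rw [lp.inner_single_left, lp.single_apply_ne _ _ _ (hσ.ne hij), inner_zero_right]

theorem lp_two_clm_ext {ι E : Type*} [DecidableEq ι] [NormedAddCommGroup E] [NormedSpace ℂ E]
    {S T : lp (fun _ : ι => ℂ) 2 →L[ℂ] E}
    (h : ∀ i, S (lp.single 2 i 1) = T (lp.single 2 i 1)) : S = T := by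
  refine lp.ext_continuousLinearMap (by norm_num) fun i => ?_
  ext
  simpa using h i

theorem lp_single_eq_smul {ι : Type*} [DecidableEq ι] (i : ι) (c : ℂ) :
    (lp.single 2 i c : lp (fun _ : ι => ℂ) 2) = c • lp.single 2 i 1 := by
  rw [← lp.single_smul, smul_eq_mul, mul_one]

/-- Every point `μ` of the unit circle is an eigenvalue of the unitary in some pair with the given
commutation relation. -/
theorem exists_unitaryIsometry_eigenvector (θ : ℝ) {μ : ℂ} (hμ : ‖μ‖ = 1) :
    ∃ (H : Type u) (_ : NormedAddCommGroup H) (_ : InnerProductSpace ℂ H) (_ : CompleteSpace H)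
      (u v : H →L[ℂ] H) (e : H), u ∈ unitary (H →L[ℂ] H) ∧ Isometry v ∧
      u * v = exp (2 * Real.pi * I * θ) • (v * u) ∧ e ≠ 0 ∧ u e = μ • e := by
  set c := exp (2 * Real.pi * I * θ)
  have hc : ‖c‖ = 1 := norm_exp_two_pi_I_mul θ
  let ι := ULift.{u} ℕ
  -- `u` is diagonal with entries `μ * c ^ n`, and `v` is the shift; `u` has the eigenvector `e₀`.
  let w : ι → ℂ := fun n => μ * c ^ n.down
  have hw : ∀ n, ‖w n‖ = 1 := fun n => by simp [w, hμ, hc]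
  have hw0 : ∀ n, w n ≠ 0 := fun n h => by simpa [h] using hw n
  obtain ⟨v, hv, hve⟩ := exists_isometry_lp_single (orthonormal_lp_single (ι := ι)
    (σ := fun n => ⟨n.down + 1⟩) (fun m n h => by
      have := congrArg ULift.down h
      exact ULift.ext _ _ (Nat.succ_injective this)) (w := fun _ => 1) (by simp))
  obtain ⟨u, hu, hue⟩ := exists_isometry_lp_single (orthonormal_lp_single (ι := ι)
    Function.injective_id hw)
  -- The diagonal operator with the inverse entries is a right inverse of `u`, hence its adjoint.
  obtain ⟨u', -, hue'⟩ := exists_isometry_lp_single (orthonormal_lp_single (ι := ι)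
    Function.injective_id (w := fun n => (w n)⁻¹) (by simp [hw]))
  simp only [id] at hue hue'
  have huu' : u * u' = 1 := by
    refine lp_two_clm_ext fun n => ?_
    rw [mul_apply_eq_comp, hue', lp_single_eq_smul, map_smul, hue, lp_single_eq_smul,
      smul_smul, inv_mul_cancel₀ (hw0 n), one_smul]
    rfl
  have hu1 : star u * u = 1 := isometry_iff_star_mul_self.mp hu
  have hstar : star u = u' := by
    rw [← mul_one (star u), ← huu', ← mul_assoc, hu1, one_mul]
  refine ⟨lp (fun _ : ι => ℂ) 2, inferInstance, inferInstance, inferInstance, u, v,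
    lp.single 2 ⟨0⟩ 1, ⟨hu1, by rw [hstar, huu']⟩, hv, ?_, ?_, ?_⟩
  · refine lp_two_clm_ext fun n => ?_
    rw [smul_apply, mul_apply_eq_comp,
      mul_apply_eq_comp, hve, hue, hue, lp_single_eq_smul _ (w n), map_smul, hve,
      lp_single_eq_smul, smul_smul]
    congr 1
    simp only [w]; ring
  · intro h
    have := congrArg norm h
    rw [lp.norm_single (by norm_num)] at this
    simp at this
  · rw [hue, lp_single_eq_smul]
    simp [w]

end UniversalAlgebra

/-! ### The crossed product by rotation -/

section CrossedProduct

open scoped CStarAlgebra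

theorem eq_of_fourier_one_eq {A : Type*} [CStarAlgebra A] {φ ψ : C(UnitAddCircle, ℂ) →⋆ₐ[ℂ] A}
    (h : φ (fourier 1) = ψ (fourier 1)) : φ = ψ :=
  starAlgHom_ext_of_closure_adjoin closure_adjoin_fourier_one (by rintro _ rfl; exact h)

/-- An eigenvector of the unitary `π (fourier 1)` is an eigenvector of `π f` for every `f`, with
eigenvalue the value of `f` at the corresponding point. -/
theorem apply_eigenvector {H : Type*} [NormedAddCommGroup H] [InnerProductSpace ℂ H]
    [CompleteSpace H] (π : C(UnitAddCircle, ℂ) →⋆ₐ[ℂ] (H →L[ℂ] H)) {e : H} {x : UnitAddCircle}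
    (h : π (fourier 1) e = fourier 1 x • e) (f : C(UnitAddCircle, ℂ)) : π f e = f x • e := by
  have hπ : Continuous π := map_continuous π
  -- The claim for `star f` is carried along to make the property stable under `star`.
  refine (closure_adjoin_induction closure_adjoin_fourier_one
    (p := fun f => π f e = f x • e ∧ π (star f) e = star (f x) • e) ?_ ?_ ?_ ?_ ?_ ?_ f).1
  · exact (isClosed_eq (by fun_prop) (by fun_prop)).inter
      (isClosed_eq (by fun_prop) (by fun_prop))
  · rintro _ rfl
    refine ⟨h, ?_⟩
    have hz : (star (fourier 1) * fourier 1 : C(UnitAddCircle, ℂ)) = 1 :=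
      Unitary.star_mul_self_of_mem fourier_one_mem_unitary
    have h1 : π (star (fourier 1)) (π (fourier 1) e) = e := by
      rw [← mul_apply_eq_comp, ← map_mul, hz, map_one]; rfl
    have h2 : star (fourier 1 x : ℂ) * fourier 1 x = 1 := congrArg (fun g => g x) hz
    rw [h, map_smul] at h1
    rw [← one_smul ℂ (π (star (fourier 1)) e), ← h2, mul_smul, h1]
  · intro r
    simp [Algebra.algebraMap_eq_smul_one]
  · rintro f g ⟨hf, hf'⟩ ⟨hg, hg'⟩
    simp [map_add, hf, hf', hg, hg', add_smul]
  · rintro f g ⟨hf, hf'⟩ ⟨hg, hg'⟩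
    constructor
    · rw [map_mul, mul_apply_eq_comp, hg, map_smul, hf, smul_smul, mul_comm]; rfl
    · rw [star_mul, map_mul, mul_apply_eq_comp, hf', map_smul, hg', smul_smul, ← star_mul,
        mul_comm]; rfl
  · rintro f ⟨hf, hf'⟩
    refine ⟨hf', ?_⟩
    rw [star_star, hf]
    simp

/-- Injectivity of `ι` is seen on the pairs whose unitary has a prescribed eigenvalue; the
other properties follow from the commutation relation by density. -/
theorem IsUniversalUnitaryIsometry.isCrossedProduct {θ : ℝ} {B : Type u} [CStarAlgebra B]
    {U V : B} (h : IsUniversalUnitaryIsometry θ U V) (ι : C(UnitAddCircle, ℂ) →⋆ₐ[ℂ] B)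
    (hι : ι (fourier 1) = U) : IsCrossedProduct (rotationHom θ) ι V := by
  have hrel : ι (fourier 1) * V = exp (2 * Real.pi * I * θ) • (V * ι (fourier 1)) := by
    rw [hι]; exact h.relation
  refine
    { injective := (injective_iff_map_eq_zero _).mpr fun f hf => ?_
      isometry := h.isometry
      generates := ?_
      covariant := covariant_of_relation θ ι hrel
      commute := commute_of_relation θ ι hrel
      lift := ?_ }
  · ext x
    obtain ⟨H, _, _, _, u, v, e, hu, hv, huv, he, hue⟩ :=
      exists_unitaryIsometry_eigenvector.{u} θ (μ := fourier 1 x) (by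
        rw [fourier_one]; exact Circle.norm_coe _)
    obtain ⟨π, hπU, -⟩ := h.lift H u v hu hv huv
    have h1 := apply_eigenvector (π.comp ι) (e := e) (x := x) (by
      rw [StarAlgHom.comp_apply, hι, hπU, hue]) f
    rw [StarAlgHom.comp_apply, hf, map_zero] at h1
    exact (smul_eq_zero.mp h1.symm).resolve_right he
  · rw [eq_top_iff, ← h.generates]
    refine StarSubalgebra.topologicalClosure_mono (StarAlgebra.adjoin_mono ?_)
    rintro _ (rfl | rfl)
    · exact Or.inl ⟨_, hι⟩
    · exact Or.inr rfl
  · intro H _ _ _ π W hW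
    obtain ⟨ρ, hρU, hρV⟩ := h.lift H (π (fourier 1)) W
      (Unitary.map_mem π fourier_one_mem_unitary) hW.isometry
      (relation_of_covariant θ π (hW.covariant _))
    refine ⟨ρ, fun f => ?_, hρV⟩
    have : ρ.comp ι = π := eq_of_fourier_one_eq (by rw [StarAlgHom.comp_apply, hι, hρU])
    rw [← this, StarAlgHom.comp_apply]

theorem IsCrossedProduct.isUniversalUnitaryIsometry {θ : ℝ} {B : Type u} [CStarAlgebra B]
    {ι : C(UnitAddCircle, ℂ) →⋆ₐ[ℂ] B} {t : B} (h : IsCrossedProduct (rotationHom θ) ι t) :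
    IsUniversalUnitaryIsometry θ (ι (fourier 1)) t := by
  refine
    { unitary := Unitary.map_mem ι fourier_one_mem_unitary
      isometry := h.isometry
      relation := relation_of_covariant θ ι (h.covariant _)
      generates := ?_
      lift := fun H _ _ _ u v hu hv huv => ?_ }
  · set S := (StarAlgebra.adjoin ℂ {ι (fourier 1), t}).topologicalClosure
    have hS : IsClosed (S : Set B) := StarSubalgebra.isClosed_topologicalClosure _
    have hsub : ({ι (fourier 1), t} : Set B) ⊆ S :=
      (StarAlgebra.subset_adjoin ℂ _).trans (StarSubalgebra.le_topologicalClosure _)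
    rw [eq_top_iff, ← h.generates]
    refine StarSubalgebra.topologicalClosure_minimal (StarAlgebra.adjoin_le ?_) hS
    rintro _ (⟨f, rfl⟩ | rfl)
    · have hle : (⊤ : StarSubalgebra ℂ C(UnitAddCircle, ℂ)) ≤ S.comap ι := by
        rw [← closure_adjoin_fourier_one]
        refine StarSubalgebra.topologicalClosure_minimal (StarAlgebra.adjoin_le ?_)
          (hS.preimage (map_continuous ι))
        rintro _ rfl
        exact hsub (by simp)
      exact hle (StarSubalgebra.mem_top (x := f))
    · exact hsub (by simp)
  · obtain ⟨π, hπ⟩ := exists_starAlgHom_fourier_one hu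
    rw [← hπ] at huv
    obtain ⟨ρ, hρ, hρt⟩ := h.lift H π v
      { isometry := hv
        covariant := covariant_of_relation θ π huv
        commute := commute_of_relation θ π huv }
    exact ⟨ρ, by rw [hρ, hπ], hρt⟩

/-- The universal property for arbitrary C⋆-algebras in place of algebras of operators. -/
theorem IsUniversalUnitaryIsometry.exists_starAlgHom {θ : ℝ} {B D : Type u} [CStarAlgebra B]
    [CStarAlgebra D] {U V : B} (h : IsUniversalUnitaryIsometry θ U V) {a b : D}
    (ha : a ∈ _root_.unitary D) (hb : star b * b = 1)
    (hab : a * b = exp (2 * Real.pi * I * θ) • (b * a)) :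
    ∃ χ : B →⋆ₐ[ℂ] D, χ U = a ∧ χ V = b := by
  have hgen : (StarAlgebra.adjoin ℂ (Set.range ![U, V])).topologicalClosure = ⊤ := by
    rw [Matrix.range_cons_cons_empty]; exact h.generates
  obtain ⟨χ, hχ⟩ := exists_starAlgHom_of_representations hgen ![a, b] fun H _ _ _ π => by
    obtain ⟨ρ, hρU, hρV⟩ := h.lift H (π a) (π b) (Unitary.map_mem π ha)
      (isometry_iff_star_mul_self.mpr (by rw [← map_star, ← map_mul, hb, map_one]))
      (by rw [← map_mul, hab, map_smul, map_mul])
    refine ⟨ρ, fun i => ?_⟩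
    fin_cases i
    exacts [hρU, hρV]
  exact ⟨χ, hχ 0, hχ 1⟩

end CrossedProduct

/-- `C(ℝ/ℤ) ⋊_{α_θ} ℕ` exists and is the universal C⋆-algebra generated by a unitary `U` and an
isometry `V` with `U V = exp(2πiθ) V U`, where `U` is the image of the function
`fourier 1 : x ↦ exp(2πix)` and `V` is the canonical isometry `t`. -/
theorem mainTheorem10 (θ : ℝ) (hθ : Irrational θ) :
    (∃ (B : Type u) (_ : CStarAlgebra B) (ι : C(UnitAddCircle, ℂ) →⋆ₐ[ℂ] B) (t : B),
      IsCrossedProduct (rotationHom θ) ι t) ∧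
    ∀ (B : Type u) [CStarAlgebra B] (ι : C(UnitAddCircle, ℂ) →⋆ₐ[ℂ] B) (t : B),
      IsCrossedProduct (rotationHom θ) ι t →
        IsUniversalUnitaryIsometry θ (ι (fourier 1)) t ∧
        ∀ (D : Type u) [CStarAlgebra D] (U V : D), IsUniversalUnitaryIsometry θ U V →
          ∃! Φ : B ≃⋆ₐ[ℂ] D, Φ (ι (fourier 1)) = U ∧ Φ t = V := by
  refine ⟨?_, fun B _ ι t h => ⟨h.isUniversalUnitaryIsometry, fun D _ U V hD => ?_⟩⟩
  · obtain ⟨B, _, U, V, h⟩ := exists_isUniversalUnitaryIsometry.{u} θ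
    obtain ⟨ι, hι⟩ := exists_starAlgHom_fourier_one h.unitary
    exact ⟨B, inferInstance, ι, V, h.isCrossedProduct ι hι⟩
  · have hB := h.isUniversalUnitaryIsometry
    obtain ⟨Φ, hΦU, hΦV⟩ := hB.exists_starAlgHom hD.unitary hD.isometry hD.relation
    obtain ⟨Ψ, hΨU, hΨV⟩ := hD.exists_starAlgHom hB.unitary hB.isometry hB.relation
    have h1 : Ψ.comp Φ = StarAlgHom.id ℂ B :=
      starAlgHom_ext_of_closure_adjoin hB.generates (by
        rintro _ (rfl | rfl)
        · rw [StarAlgHom.comp_apply, hΦU, hΨU]; rfl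
        · rw [StarAlgHom.comp_apply, hΦV, hΨV]; rfl)
    have h2 : Φ.comp Ψ = StarAlgHom.id ℂ D :=
      starAlgHom_ext_of_closure_adjoin hD.generates (by
        rintro _ (rfl | rfl)
        · rw [StarAlgHom.comp_apply, hΨU, hΦU]; rfl
        · rw [StarAlgHom.comp_apply, hΨV, hΦV]; rfl)
    refine ⟨StarAlgEquiv.ofStarAlgHom Φ Ψ h1 h2, ⟨hΦU, hΦV⟩, fun Θ hΘ => ?_⟩
    have h3 : (Θ : B →⋆ₐ[ℂ] D) = Φ :=
      starAlgHom_ext_of_closure_adjoin hB.generates (by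
        rintro _ (rfl | rfl)
        · exact hΘ.1.trans hΦU.symm
        · exact hΘ.2.trans hΦV.symm)
    ext x
    exact DFunLike.congr_fun h3 x
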